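/- Let $\mathcal{L}$ be a finite distributive lattice. Call $x\in\mathcal{L}$ join irreducible if $x=y\vee z$ always implies $x=y$ or $x=z$ (so the least element is join irreducible), and let $J$ be the poset of join irreducibles. Assume that $\mathcal{L}$ is a square lattice, i.e. the Hasse diagram of $J$ is a tree in which every vertex other than the root (the least element) has degree at most two. Let $k$ be a field, let $I(\mathcal{L})\subset k[x_\alpha : \alpha\in\mathcal{L}]$ be the ideal generated by the binomials $x_\alpha x_\beta - x_{\alpha\vee\beta}x_{\alpha\wedge\beta}$ for non-comparable $\alpha,\beta\in\mathcal{L}$, and let $k[\mathcal{L}]=k[x_\alpha : \alpha\in\mathcal{L}]/I(\mathcal{L})$ with its standard grading. Then the projective variety $X(\mathcal{L})=\mathrm{Proj}\,k[\mathcal{L}]$ is nonsingular at every point: all its local rings are regular and $X(\mathcal{L})$ is smooth over $k$. Moreover, the affine cone $\mathrm{Spec}\,k[\mathcal{L}]=V(I(\mathcal{L}))\subset\mathbb{A}^{|\mathcal{L}|}$ is nonsingular away from its vertex: at every prime $\mathfrak{p}$ of $k[\mathcal{L}]$ other than the ideal generated by all the $x_\alpha$, the local ring $k[\mathcal{L}]_{\mathfrak{p}}$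 is regular and $k[\mathcal{L}]$ is smooth over $k$ at $\mathfrak{p}$. -/

import Mathlib

open AlgebraicGeometry CategoryTheory

universe u v

namespace LatticeVariety

section Combinatorics

/-- The poset of join irreducible elements of a lattice: `x` is join irreducible if
`x = y ⊔ z` forces `x = y` or `x = z`.  A least element of the lattice counts as join irreducible
(so this is not `SupIrred`, which excludes it). -/
def joinIrreducibles (L : Type u) [DistribLattice L] : Set L :=
  {x | ∀ y z : L, x = y ⊔ z → x = y ∨ x = z}

/-- A tree lattice: the Hasse diagram of the poset of join irreducibles is a tree. -/
def IsTreeLattice (L : Type u) [DistribLattice L] : Prop :=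
  (SimpleGraph.hasse (joinIrreducibles L)).IsTree

/-- A square lattice: a tree lattice such that in the Hasse diagram of the poset of join
irreducibles every vertex other than the root (the least element) has degree at most two. -/
structure IsSquareLattice (L : Type u) [DistribLattice L] : Prop where
  isTreeLattice : IsTreeLattice L
  degree_le_two : ∀ x : joinIrreducibles L, ¬ IsBot x →
    ((SimpleGraph.hasse (joinIrreducibles L)).neighborSet x).encard ≤ 2

end Combinatorics

noncomputable section

open MvPolynomial

attribute [local instance] MvPolynomial.gradedAlgebra

variable (L : Type u) [DistribLattice L] (k : Type v) [Field k]

/-- The ideal `I(L)` of `k[x_α : α ∈ L]` generated by the diamond relations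
`x_α x_β - x_{α ⊔ β} x_{α ⊓ β}` for `α`, `β` not comparable. -/
def latticeIdeal : Ideal (MvPolynomial L k) :=
  Ideal.span {f | ∃ a b : L, ¬ a ≤ b ∧ ¬ b ≤ a ∧
    f = X a * X b - X (a ⊔ b) * X (a ⊓ b)}

/-- The homogeneous coordinate ring `k[L] = k[x_α : α ∈ L] / I(L)`. -/
abbrev LatticeRing : Type (max u v) := MvPolynomial L k ⧸ latticeIdeal L k

/-- The class of the variable `x_α` in `k[L]`. -/
def coord (a : L) : LatticeRing L k := Ideal.Quotient.mk (latticeIdeal L k) (X a)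

/-- The standard grading of `k[L]`: the degree `n` part is the image of the homogeneous polynomials
of degree `n`. -/
def grading (n : ℕ) : Submodule k (LatticeRing L k) :=
  (homogeneousSubmodule L k n).map (Ideal.Quotient.mkₐ k (latticeIdeal L k)).toLinearMap

variable {L k} in
theorem mk_mem_grading {n : ℕ} {p : MvPolynomial L k} (hp : p ∈ homogeneousSubmodule L k n) :
    Ideal.Quotient.mk (latticeIdeal L k) p ∈ grading L k n :=
  ⟨p, hp, rfl⟩

instance : SetLike.GradedMonoid (grading L k) where
  one_mem := by
    rw [← map_one (Ideal.Quotient.mk (latticeIdeal L k))]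
    exact mk_mem_grading (isHomogeneous_one L k)
  mul_mem := by
    rintro i j _ _ ⟨p, hp, rfl⟩ ⟨q, hq, rfl⟩
    exact ⟨p * q, IsHomogeneous.mul hp hq, by simp⟩

/-- The restriction of the quotient map to the degree `n` parts. -/
def gradingMk (n : ℕ) : homogeneousSubmodule L k n →ₗ[k] grading L k n :=
  (Ideal.Quotient.mkₐ k (latticeIdeal L k)).toLinearMap.restrict
    fun _ hp => mk_mem_grading hp

/-- A polynomial is sent to the family of the classes of its homogeneous components. -/
def components : MvPolynomial L k →ₐ[k] DirectSum ℕ fun n => grading L k n :=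
  (DirectSum.toAlgebra k (fun n => homogeneousSubmodule L k n)
    (fun n => (DirectSum.lof k ℕ (fun n => grading L k n) n).comp (gradingMk L k n))
    (by rfl)
    (by
      intro i j p q
      simp only [LinearMap.comp_apply, DirectSum.lof_eq_of]
      rw [DirectSum.of_mul_of]
      congr 1)).comp
    (DirectSum.decomposeAlgEquiv (homogeneousSubmodule L k)).toAlgHom

variable {L k} in
theorem components_of_mem {n : ℕ} {p : MvPolynomial L k} (hp : p ∈ homogeneousSubmodule L k n) :
    components L k p =
      DirectSum.of (fun n => grading L k n) n
        ⟨Ideal.Quotient.mk (latticeIdeal L k) p, mk_mem_grading hp⟩ := by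
  simp only [components, AlgHom.comp_apply]
  have : (DirectSum.decomposeAlgEquiv (homogeneousSubmodule L k)).toAlgHom p
      = DirectSum.of (fun n => homogeneousSubmodule L k n) n ⟨p, hp⟩ :=
    DirectSum.decompose_of_mem _ hp
  rw [this]
  exact DirectSum.toAddMonoid_of _ _ _

theorem components_eq_zero (p : MvPolynomial L k) (hp : p ∈ latticeIdeal L k) :
    components L k p = 0 := by
  have h : latticeIdeal L k ≤ RingHom.ker (components L k) := by
    refine Ideal.span_le.2 ?_
    rintro f ⟨a, b, hab, hba, rfl⟩
    have hm : (X a * X b - X (a ⊔ b) * X (a ⊓ b) : MvPolynomial L k)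
        ∈ homogeneousSubmodule L k 2 :=
      Submodule.sub_mem _ ((isHomogeneous_X k a).mul (isHomogeneous_X k b))
        ((isHomogeneous_X k _).mul (isHomogeneous_X k _))
    have h0 : Ideal.Quotient.mk (latticeIdeal L k) (X a * X b - X (a ⊔ b) * X (a ⊓ b)) = 0 :=
      Ideal.Quotient.eq_zero_iff_mem.2 (Ideal.subset_span ⟨a, b, hab, hba, rfl⟩)
    change components L k _ = 0
    rw [components_of_mem hm, ← map_zero (DirectSum.of (fun n => grading L k n) 2)]
    congr 1
    exact Subtype.ext h0
  exact h hp

instance : GradedAlgebra (grading L k) :=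
  GradedAlgebra.ofAlgHom (grading L k)
    (Ideal.Quotient.liftₐ (latticeIdeal L k) (components L k) (components_eq_zero L k))
    (by
      apply Ideal.Quotient.algHom_ext
      apply MvPolynomial.algHom_ext
      intro a
      change DirectSum.coeAlgHom (grading L k) (components L k (X a)) = _
      rw [components_of_mem (isHomogeneous_X k a), DirectSum.coeAlgHom_of]
      rfl)
    (by
      rintro n ⟨_, p, hp, rfl⟩
      exact components_of_mem hp)

/-- The vertex of the affine cone `Spec k[L]`: the ideal generated by all the coordinates. -/
def vertexIdeal : Ideal (LatticeRing L k) := Ideal.span (Set.range (coord L k))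

end

noncomputable section

variable (L : Type u) [DistribLattice L] (k : Type u) [Field k]

/-- The projective lattice variety `X(L) = Proj k[L]`. -/
def projVariety : Scheme.{u} := Proj (grading L k)

/-- The structure morphism `X(L) ⟶ Spec k`. -/
def structureMorphism : projVariety L k ⟶ Spec (CommRingCat.of k) :=
  Proj.toSpecZero (grading L k) ≫
    Spec.map (CommRingCat.ofHom (algebraMap k (grading L k 0)))

end

end LatticeVariety

/-! Geometrically, `X(L)` is a Segre embedding of a product of projective spaces.

In `J`, acyclicity makes the elements below any given one a chain, and the degree bound does the
same for the elements above any non-root. Deleting the root therefore leaves a disjoint union of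
chains. By Birkhoff's theorem `L` is the lattice of lower sets of this union, hence a product of
finite chains `C i` (`IsSquareLattice.exists_orderIso_pi`).

Where `x_a` is invertible, changing the coordinates of `a` into those of `b` one at a time writes
`x_b / x_a` as the product over `i` of the ratios `x_{a'} / x_a`, with `a'` differing from `a` only
in coordinate `i` (`mul_eq_prod_of_sup_inf`). These single-coordinate ratios are free, so the chart
of `Proj` at `a` is an affine space (`projChartEquiv`) and the corresponding open set of the cone is
that space times a punctured line (`coordAwayEquiv`). Such charts cover `X(L)` and the cone minus
its vertex. -/

namespace LatticeVariety

/-! ### Square lattices as products of chains -/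

section TreePosets

variable {P : Type*} [PartialOrder P] [Finite P]

theorem exists_descending_path [OrderBot P] (y : P) :
    ∃ p : (SimpleGraph.hasse P).Walk y ⊥, p.IsPath ∧ ∀ v ∈ p.support, v ≤ y := by
  induction y using WellFoundedLT.induction with
  | ind y ih =>
    rcases eq_or_ne y ⊥ with rfl | hy
    · exact ⟨.nil, by simp, by simp⟩
    · obtain ⟨z, -, hz⟩ := exists_le_covBy_of_lt (bot_lt_iff_ne_bot.2 hy)
      obtain ⟨p, hp, hle⟩ := ih z hz.lt
      refine ⟨.cons (SimpleGraph.hasse_adj.2 (Or.inr hz)) p,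
        hp.cons fun h => (hle y h).not_gt hz.lt, ?_⟩
      intro v hv
      rw [SimpleGraph.Walk.support_cons, List.mem_cons] at hv
      rcases hv with rfl | hv
      · rfl
      · exact (hle v hv).trans hz.le

/-- Prepending `x` to descending paths from `y` and from `z` gives two paths from `x` to `⊥`. Paths
in a forest are unique, so their second vertices agree. -/
theorem eq_of_covBy_of_isAcyclic [OrderBot P] (h : (SimpleGraph.hasse P).IsAcyclic) {x y z : P}
    (hy : y ⋖ x) (hz : z ⋖ x) : y = z := by
  obtain ⟨p, hp, hple⟩ := exists_descending_path y
  obtain ⟨q, hq, hqle⟩ := exists_descending_path z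
  have hp' : (SimpleGraph.Walk.cons (SimpleGraph.hasse_adj.2 (Or.inr hy)) p).IsPath :=
    hp.cons fun h => (hple x h).not_gt hy.lt
  have hq' : (SimpleGraph.Walk.cons (SimpleGraph.hasse_adj.2 (Or.inr hz)) q).IsPath :=
    hq.cons fun h => (hqle x h).not_gt hz.lt
  have := congrArg (fun w => w.1.snd) ((h.subsingleton_path _ _).elim ⟨_, hp'⟩ ⟨_, hq'⟩)
  simpa using this

/-- In a finite poset where elements have at most one lower cover, principal lower sets are
chains. -/
theorem le_total_of_le_of_covBy_unique (h : ∀ x y z : P, y ⋖ x → z ⋖ x → y = z) {x y w : P}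
    (hx : x ≤ w) (hy : y ≤ w) : x ≤ y ∨ y ≤ x := by
  induction w using WellFoundedLT.induction with
  | ind w ih =>
    rcases hx.eq_or_lt with rfl | hx'
    · exact Or.inr hy
    rcases hy.eq_or_lt with rfl | hy'
    · exact Or.inl hx
    obtain ⟨c, hc, hcw⟩ := exists_le_covBy_of_lt hx'
    obtain ⟨d, hd, hdw⟩ := exists_le_covBy_of_lt hy'
    obtain rfl := h w c d hcw hdw
    exact ih c hcw.lt hc hd

/-- A non-root vertex has a lower cover, which uses up one of its two neighbours and leaves room for
at most one upper cover. The root is excluded because it may branch freely. -/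
theorem le_total_of_ge_of_degree_le_two [OrderBot P]
    (hdeg : ∀ x : P, ¬ IsBot x → ((SimpleGraph.hasse P).neighborSet x).encard ≤ 2) {x y w : P}
    (hw : w ≠ ⊥) (hx : w ≤ x) (hy : w ≤ y) : x ≤ y ∨ y ≤ x := by
  induction w using WellFoundedGT.induction with
  | ind w ih =>
    rcases hx.eq_or_lt with rfl | hx'
    · exact Or.inl hy
    rcases hy.eq_or_lt with rfl | hy'
    · exact Or.inr hx
    obtain ⟨c, hwc, hc⟩ := exists_covBy_le_of_lt hx'
    obtain ⟨d, hwd, hd⟩ := exists_covBy_le_of_lt hy'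
    obtain ⟨p, -, hp⟩ := exists_le_covBy_of_lt (bot_lt_iff_ne_bot.2 hw)
    suffices c = d by
      subst this
      exact ih c hwc.lt ((bot_le.trans_lt hwc.lt).ne') hc hd
    by_contra hcd
    have h3 : ({p, c, d} : Set P).encard = 3 := Set.encard_eq_three.2
      ⟨p, c, d, (hp.lt.trans hwc.lt).ne, (hp.lt.trans hwd.lt).ne, hcd, rfl⟩
    have hsub : ({p, c, d} : Set P) ⊆ (SimpleGraph.hasse P).neighborSet w := by
      rintro v (rfl | rfl | rfl)
      exacts [Or.inr hp, Or.inl hwc, Or.inl hwd]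
    have := (Set.encard_le_encard hsub).trans (hdeg w fun h => hw h.eq_bot)
    rw [h3] at this
    exact absurd this (by decide)

end TreePosets

/-- The lower sets of a disjoint union of posets are the families of lower sets of its pieces. -/
def lowerSetOrderIsoPi {P ι : Type*} [PartialOrder P] (f : P → ι)
    (hf : ∀ a b, a ≤ b → f a = f b) :
    LowerSet P ≃o ∀ i, LowerSet {a : P // f a = i} where
  toFun s i := ⟨{a | a.1 ∈ s}, fun _ _ hba ha => s.lower hba ha⟩
  invFun t := ⟨{a | (⟨a, rfl⟩ : {b : P // f b = f a}) ∈ t (f a)}, by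
    intro a b hba ha
    -- The indices `f a` and `f b` are only propositionally equal, so they are generalized before
    -- being identified.
    have key : ∀ (i j : ι) (hij : i = j) (hi : f a = i) (hj : f b = j),
        (⟨a, hi⟩ : {c : P // f c = i}) ∈ t i → (⟨b, hj⟩ : {c : P // f c = j}) ∈ t j := by
      rintro i _ rfl hi hj h
      exact (t i).lower (show (⟨b, hj⟩ : {c : P // f c = i}) ≤ ⟨a, hi⟩ from hba) h
    exact key _ _ (hf b a hba).symm rfl rfl ha⟩
  left_inv s := by ext; rfl
  right_inv t := by
    funext i
    ext ⟨a, rfl⟩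
    rfl
  map_rel_iff' {s t} := by
    constructor
    · exact fun h a ha => h (f a) (show (⟨a, rfl⟩ : {b : P // f b = f a}) ∈ _ from ha)
    · exact fun h i a ha => h ha

/-- A finite square lattice is a product of finitely many finite chains. -/
theorem IsSquareLattice.exists_orderIso_pi {L : Type u} [DistribLattice L] [Finite L]
    (hL : IsSquareLattice L) :
    ∃ (ι : Type u) (C : ι → Type u) (_ : ∀ i, LinearOrder (C i)) (_ : Finite ι)
      (_ : ∀ i, Finite (C i)), Nonempty (L ≃o ∀ i, C i) := by
  classical
  have : Nonempty (joinIrreducibles L) := hL.isTreeLattice.1.nonempty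
  have : Nonempty L := this.map Subtype.val
  let _ := Fintype.ofFinite L
  let _ : OrderBot L := Fintype.toOrderBot L
  have hbot : (⊥ : L) ∈ joinIrreducibles L := fun y z h =>
    Or.inl (sup_eq_bot_iff.1 h.symm).1.symm
  let _ : OrderBot (joinIrreducibles L) :=
    { bot := ⟨⊥, hbot⟩, bot_le := fun a => (bot_le : (⊥ : L) ≤ a.1) }
  -- `SupIrred` excludes `⊥`, so `P` is the poset of join irreducibles with its root deleted.
  let P := {a : L // SupIrred a}
  let j : P → joinIrreducibles L := fun a => ⟨a.1, fun y z h =>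
    (a.2.2 h.symm).imp Eq.symm Eq.symm⟩
  have hj : ∀ a, j a ≠ ⊥ := fun a h => a.2.1 (by
    have : a.1 = ⊥ := congrArg Subtype.val h
    rw [this]
    exact isMin_bot)
  have hdown : ∀ {x y w : P}, x ≤ w → y ≤ w → x ≤ y ∨ y ≤ x := fun {x y w} hx hy =>
    le_total_of_le_of_covBy_unique (w := j w) (x := j x) (y := j y)
      (fun _ _ _ => eq_of_covBy_of_isAcyclic hL.isTreeLattice.2) hx hy
  have hup : ∀ {x y w : P}, w ≤ x → w ≤ y → x ≤ y ∨ y ≤ x := fun {x y w} hx hy =>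
    le_total_of_ge_of_degree_le_two (w := j w) (x := j x) (y := j y) hL.degree_le_two (hj w) hx hy
  -- Comparability is transitive because both the elements below and the elements above a given
  -- element of `P` form chains; its classes are the chains sought.
  let s : Setoid P :=
    { r := fun a b => a ≤ b ∨ b ≤ a
      iseqv :=
        { refl := fun a => Or.inl le_rfl
          symm := Or.symm
          trans := by
            rintro a b c (h | h) (h' | h')
            exacts [Or.inl (h.trans h'), hdown h h', hup h h', Or.inr (h'.trans h)] } }
  let f : P → Quotient s := Quotient.mk s
  have htot : ∀ i : Quotient s, Std.Total (α := {a : P // f a = i}) (· ≤ ·) := fun i =>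
    ⟨fun a b => Quotient.exact (a.2.trans b.2.symm)⟩
  let lin : ∀ i : Quotient s, LinearOrder {a : P // f a = i} := fun i =>
    { (inferInstance : PartialOrder {a : P // f a = i}) with
      le_total := (htot i).total
      toDecidableLE := Classical.decRel _ }
  let lin' : ∀ i : Quotient s, LinearOrder (LowerSet {a : P // f a = i}) := fun i =>
    letI := lin i
    LowerSet.instLinearOrder
  refine ⟨Quotient s, fun i => LowerSet {a : P // f a = i}, lin', inferInstance,
    fun i => Finite.of_injective _ SetLike.coe_injective, ⟨?_⟩⟩
  exact (OrderIso.lowerSetSupIrred (α := L)).trans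
    (lowerSetOrderIsoPi f fun a b h => Quotient.sound (Or.inl h))

/-! ### Regularity and smoothness under localization -/

section Regular

variable {R S : Type*} [CommRing R] [CommRing S] [Algebra R S]

theorem isRegularRing_of_isLocalization (M : Submonoid R) [IsLocalization M S] [IsRegularRing R] :
    IsRegularRing S := by
  have : IsNoetherianRing S := IsLocalization.isNoetherianRing M S inferInstance
  refine isRegularRing_iff.2 fun p _ => ?_
  have : IsLocalization.AtPrime (Localization.AtPrime p) (p.comap (algebraMap R S)) :=
    IsLocalization.isLocalization_isLocalization_atPrime_isLocalization M _ p
  exact IsRegularLocalRing.of_ringEquiv (IsLocalization.algEquiv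
    (p.comap (algebraMap R S)).primeCompl
    (Localization.AtPrime (p.comap (algebraMap R S))) (Localization.AtPrime p)).toRingEquiv

theorem isRegularLocalRing_of_isRegularRing_away (f : R) [IsLocalization.Away f S]
    [IsRegularRing S] (p : PrimeSpectrum R) (hp : f ∉ p.asIdeal) :
    IsRegularLocalRing (Localization.AtPrime p.asIdeal) := by
  have hmem : p ∈ Set.range (PrimeSpectrum.comap (algebraMap R S)) := by
    rw [PrimeSpectrum.localization_away_comap_range S f]
    exact hp
  obtain ⟨q, rfl⟩ := hmem
  have : IsLocalization.AtPrime (Localization.AtPrime q.asIdeal)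
      (PrimeSpectrum.comap (algebraMap R S) q).asIdeal :=
    IsLocalization.isLocalization_isLocalization_atPrime_isLocalization (.powers f) _ q.asIdeal
  exact IsRegularLocalRing.of_ringEquiv (IsLocalization.algEquiv
    (PrimeSpectrum.comap (algebraMap R S) q).asIdeal.primeCompl
    (Localization.AtPrime q.asIdeal) (Localization.AtPrime _)).toRingEquiv

theorem isSmoothAt_of_smooth_away {k : Type*} [CommRing k] [Algebra k R] [Algebra k S]
    [IsScalarTower k R S] (f : R) [IsLocalization.Away f S] [Algebra.Smooth k S]
    (p : PrimeSpectrum R) (hp : f ∉ p.asIdeal) : Algebra.IsSmoothAt k p.asIdeal := by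
  have hmem : p ∈ Set.range (PrimeSpectrum.comap (algebraMap R S)) := by
    rw [PrimeSpectrum.localization_away_comap_range S f]
    exact hp
  obtain ⟨q, rfl⟩ := hmem
  have h : q ∈ PrimeSpectrum.comap (algebraMap R S) ⁻¹' Algebra.smoothLocus k R := by
    rw [Algebra.smoothLocus_comap_of_isLocalization f, Algebra.smoothLocus_eq_univ]
    trivial
  exact h

end Regular

/-! ### Factorization of ratios in a product of chains -/

section Products

variable {L : Type*} [Lattice L] {ι : Type*} {C : ι → Type*} [∀ i, LinearOrder (C i)]
  (e : L ≃o ∀ i, C i)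

open Classical in
/-- The element of a product of chains whose coordinates are those of `b` on `s` and those of `a`
elsewhere. -/
noncomputable def splice (a b : L) (s : Finset ι) : L := e.symm (s.piecewise (e b) (e a))

open Classical in
/-- The element obtained from `a` by changing a single coordinate. -/
noncomputable def adjust (a : L) (i : ι) (c : C i) : L := e.symm (Function.update (e a) i c)

open Classical in
-- The two pairs have the same unordered pair of entries in every coordinate: at `i` the entries are
-- swapped, and elsewhere they coincide.
theorem splice_sup_inf (a b : L) {s : Finset ι} {i : ι} (hi : i ∉ s) :
    splice e a b (insert i s) ⊔ a = splice e a b s ⊔ adjust e a i (e b i) ∧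
      splice e a b (insert i s) ⊓ a = splice e a b s ⊓ adjust e a i (e b i) := by
  constructor <;> refine e.injective (funext fun l => ?_) <;>
    simp only [splice, adjust, map_sup, map_inf, OrderIso.apply_symm_apply, Pi.sup_apply,
      Pi.inf_apply] <;> rcases eq_or_ne l i with rfl | h <;>
    simp [*, sup_comm, inf_comm, Finset.piecewise]

theorem mul_eq_prod_of_sup_inf [Fintype ι] {B : Type*} [CommRing B] (x : L → B)
    (hx : ∀ a b, x a * x b = x (a ⊔ b) * x (a ⊓ b)) (a : L) (u : B) (hu : u * x a = 1) (b : L) :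
    u * x b = ∏ i, u * x (adjust e a i (e b i)) := by
  classical
  have key : ∀ s : Finset ι, u * x (splice e a b s) = ∏ i ∈ s, u * x (adjust e a i (e b i)) := by
    intro s
    induction s using Finset.induction_on with
    | empty => simp [splice, hu]
    | insert i s hi ih =>
      rw [Finset.prod_insert hi, ← ih]
      obtain ⟨h1, h2⟩ := splice_sup_inf e a b hi
      have h := hx (splice e a b (insert i s)) a
      rw [h1, h2, ← hx] at h
      -- Multiply the diamond relation by `u * u` and cancel one factor `u * x a = 1`.
      linear_combination (-u * x (splice e a b (insert i s))) * hu + u * u * h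
  simpa [splice] using key Finset.univ

end Products

/-! ### The lattice ring and its localizations at the coordinates -/

noncomputable section

open MvPolynomial

attribute [local instance] MvPolynomial.gradedAlgebra

variable {L : Type u} [DistribLattice L] (k : Type v) [Field k]

theorem coord_mul_coord (a b : L) :
    coord L k a * coord L k b = coord L k (a ⊔ b) * coord L k (a ⊓ b) := by
  by_cases hab : a ≤ b
  · rw [sup_eq_right.2 hab, inf_eq_left.2 hab, mul_comm]
  by_cases hba : b ≤ a
  · rw [sup_eq_left.2 hba, inf_eq_right.2 hba]
  · exact Ideal.Quotient.eq.2 (Ideal.subset_span ⟨a, b, hab, hba, rfl⟩)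

variable {k} in
/-- The homomorphism out of `k[L]` given by a family satisfying the diamond relations. -/
def liftCoord {B : Type*} [CommRing B] [Algebra k B] (x : L → B)
    (hx : ∀ a b, x a * x b = x (a ⊔ b) * x (a ⊓ b)) : LatticeRing L k →ₐ[k] B :=
  Ideal.Quotient.liftₐ (latticeIdeal L k) (aeval x) (by
    have h : latticeIdeal L k ≤ RingHom.ker (aeval (R := k) x) := by
      refine Ideal.span_le.2 ?_
      rintro f ⟨a, b, -, -, rfl⟩
      simp [RingHom.mem_ker, hx a b]
    exact fun p hp => h hp)

variable {k} in
@[simp]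
theorem liftCoord_coord {B : Type*} [CommRing B] [Algebra k B] (x : L → B)
    (hx : ∀ a b, x a * x b = x (a ⊔ b) * x (a ⊓ b)) (a : L) :
    liftCoord (k := k) x hx (coord L k a) = x a := by
  change aeval x (X a) = _
  simp

variable {k} in
theorem latticeRing_algHom_ext {B : Type*} [CommRing B] [Algebra k B]
    {f g : LatticeRing L k →ₐ[k] B} (h : ∀ a, f (coord L k a) = g (coord L k a)) : f = g :=
  Ideal.Quotient.algHom_ext _ (MvPolynomial.algHom_ext h)

section Charts

variable {ι : Type u} {C : ι → Type u} [∀ i, LinearOrder (C i)] [Finite ι]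
  (e : L ≃o ∀ i, C i) (a : L)

/-- The index set of the affine coordinates on the chart at `a`. -/
abbrev ChartIndex : Type u := Σ i, {c : C i // c ≠ e a i}

/-- The affine coordinate attached to a value of a single coordinate of the product. -/
def chartCoord (i : ι) (c : C i) : MvPolynomial (ChartIndex e a) k :=
  open Classical in if h : c = e a i then 1 else X ⟨i, c, h⟩

/-- The restriction of `x_b / x_a` to the chart at `a`. -/
def chartMonomial (b : L) : MvPolynomial (ChartIndex e a) k :=
  letI := Fintype.ofFinite ι
  ∏ i, chartCoord k e a i (e b i)

@[simp]
theorem chartMonomial_self : chartMonomial k e a a = 1 := by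
  simp [chartMonomial, chartCoord]

/-- In a chain the join and meet of two entries are the entries themselves in some order, so the
identity holds factor by factor. -/
theorem chartMonomial_mul (b c : L) :
    chartMonomial k e a b * chartMonomial k e a c =
      chartMonomial k e a (b ⊔ c) * chartMonomial k e a (b ⊓ c) := by
  simp only [chartMonomial, ← Finset.prod_mul_distrib]
  refine Finset.prod_congr rfl fun i _ => ?_
  simp only [map_sup, map_inf, Pi.sup_apply, Pi.inf_apply]
  rcases le_total (e b i) (e c i) with h | h
  · rw [sup_eq_right.2 h, inf_eq_left.2 h, mul_comm]
  · rw [sup_eq_left.2 h, inf_eq_right.2 h]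

theorem chartMonomial_adjust (j : ChartIndex e a) :
    chartMonomial k e a (adjust e a j.1 j.2.1) = X j := by
  classical
  let _ := Fintype.ofFinite ι
  obtain ⟨i, c, hc⟩ := j
  rw [chartMonomial, Finset.prod_eq_single i]
  · simp [adjust, chartCoord, hc]
  · intro l _ hl
    simp [adjust, chartCoord, hl]
  · simp

/-- The localization of `k[L]` at `x_a`. -/
abbrev CoordAway : Type (max u v) := Localization.Away (coord L k a)

/-- The fraction `x_b / x_a`. -/
def ratio (b : L) : CoordAway k a :=
  IsLocalization.Away.invSelf (coord L k a) * algebraMap _ _ (coord L k b)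

theorem ratio_self : ratio k a a = 1 := by
  rw [ratio, mul_comm, IsLocalization.Away.mul_invSelf]

/-- The polynomial ring on the affine coordinates at `a` maps to the localization at `x_a`. -/
def ofChart : MvPolynomial (ChartIndex e a) k →ₐ[k] CoordAway k a :=
  aeval fun j => ratio k a (adjust e a j.1 j.2.1)

theorem ofChart_chartMonomial (b : L) : ofChart k e a (chartMonomial k e a b) = ratio k a b := by
  classical
  let _ := Fintype.ofFinite ι
  rw [ratio, mul_eq_prod_of_sup_inf e (fun b => algebraMap _ (CoordAway k a) (coord L k b))
    (fun b c => by rw [← map_mul, coord_mul_coord, map_mul]) a _ (ratio_self k a) b,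
    chartMonomial, map_prod]
  refine Finset.prod_congr (by congr!) fun i _ => ?_
  rw [chartCoord]
  split_ifs with h
  · rw [map_one, h, adjust, Function.update_eq_self, OrderIso.symm_apply_apply]
    exact (ratio_self k a).symm
  · simp [ofChart, ratio]

/-- Dehomogenization at `x_a`. -/
def toChart : CoordAway k a →ₐ[k] MvPolynomial (ChartIndex e a) k :=
  IsLocalization.liftAlgHom (M := Submonoid.powers (coord L k a))
    (f := liftCoord (chartMonomial k e a) (chartMonomial_mul k e a)) (by
      rintro ⟨_, n, rfl⟩
      simp)

theorem toChart_algebraMap (x : LatticeRing L k) :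
    toChart k e a (algebraMap _ _ x) =
      liftCoord (chartMonomial k e a) (chartMonomial_mul k e a) x :=
  IsLocalization.lift_eq _ _

/-- Dehomogenization sends `x_a` to `1`, hence its inverse to `1` as well. -/
theorem toChart_ratio (b : L) : toChart k e a (ratio k a b) = chartMonomial k e a b := by
  have h : ∀ b, toChart k e a (algebraMap _ _ (coord L k b)) = chartMonomial k e a b := fun b => by
    rw [toChart_algebraMap, liftCoord_coord]
  have h1 := congrArg (toChart k e a) (ratio_self k a)
  rw [ratio, map_mul, h, chartMonomial_self, mul_one, map_one] at h1
  rw [ratio, map_mul, h, h1, one_mul]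

/-- This makes `toChart` injective on the range of `ofChart`, which contains the degree-zero
fractions. -/
theorem toChart_ofChart (p : MvPolynomial (ChartIndex e a) k) :
    toChart k e a (ofChart k e a p) = p := by
  have : (toChart k e a).comp (ofChart k e a) = AlgHom.id k _ := by
    refine MvPolynomial.algHom_ext fun j => ?_
    simp [ofChart, toChart_ratio, chartMonomial_adjust]
  exact DFunLike.congr_fun this p

end Charts

/-! ### Charts of the affine cone -/

section Cone

variable {ι : Type u} {C : ι → Type u} [∀ i, LinearOrder (C i)] [Finite ι]
  (e : L ≃o ∀ i, C i) (a : L)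

/-- The product of the chart at `a` with the punctured line. -/
abbrev ConeChart : Type (max u v) :=
  Localization.Away (X none : MvPolynomial (Option (ChartIndex e a)) k)

/-- The coordinate `x_b` on the affine cone over the chart at `a`. -/
def coneCoord (b : L) : ConeChart k e a :=
  algebraMap _ _ (X none * rename some (chartMonomial k e a b))

theorem coneCoord_mul (b c : L) :
    coneCoord k e a b * coneCoord k e a c =
      coneCoord k e a (b ⊔ c) * coneCoord k e a (b ⊓ c) := by
  simp only [coneCoord]
  rw [← map_mul, ← map_mul, mul_mul_mul_comm, ← map_mul (rename some), chartMonomial_mul,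
    map_mul (rename some), mul_mul_mul_comm]

/-- The comparison map from the localization at `x_a` to the affine cone over the chart. -/
def toConeChart : CoordAway k a →ₐ[k] ConeChart k e a :=
  IsLocalization.liftAlgHom (M := Submonoid.powers (coord L k a))
    (f := liftCoord (coneCoord k e a) (coneCoord_mul k e a)) (by
      rintro ⟨_, n, rfl⟩
      simp only [map_pow, liftCoord_coord, coneCoord, chartMonomial_self, map_one, mul_one]
      exact (IsLocalization.Away.algebraMap_isUnit _).pow n)

theorem toConeChart_coord (b : L) :
    toConeChart k e a (algebraMap _ _ (coord L k b)) = coneCoord k e a b :=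
  (IsLocalization.lift_eq _ _).trans (liftCoord_coord _ _ _)

theorem toConeChart_ratio (b : L) :
    toConeChart k e a (ratio k a b) =
      algebraMap _ (ConeChart k e a) (rename some (chartMonomial k e a b)) := by
  have h1 := congrArg (toConeChart k e a) (ratio_self k a)
  rw [ratio, map_mul, toConeChart_coord, coneCoord, chartMonomial_self, map_one, mul_one,
    map_one] at h1
  rw [ratio, map_mul, toConeChart_coord, coneCoord, map_mul, ← mul_assoc, h1, one_mul]

/-- The inverse comparison map, before inverting the additional variable. -/
def ofConePoly : MvPolynomial (Option (ChartIndex e a)) k →ₐ[k] CoordAway k a :=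
  aeval fun o => o.elim (algebraMap _ _ (coord L k a)) fun j => ratio k a (adjust e a j.1 j.2.1)

omit [Finite ι] in
theorem ofConePoly_rename (p : MvPolynomial (ChartIndex e a) k) :
    ofConePoly k e a (rename some p) = ofChart k e a p := by
  rw [ofConePoly, aeval_rename]
  rfl

/-- The inverse of the comparison map. -/
def ofConeChart : ConeChart k e a →ₐ[k] CoordAway k a :=
  IsLocalization.liftAlgHom
    (M := Submonoid.powers (X none : MvPolynomial (Option (ChartIndex e a)) k))
    (f := ofConePoly k e a) (by
      rintro ⟨_, n, rfl⟩
      simp only [map_pow, ofConePoly, aeval_X, Option.elim]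
      exact (IsLocalization.Away.algebraMap_isUnit _).pow n)

omit [Finite ι] in
theorem ofConeChart_algebraMap (p : MvPolynomial (Option (ChartIndex e a)) k) :
    ofConeChart k e a (algebraMap _ _ p) = ofConePoly k e a p :=
  IsLocalization.lift_eq _ _

/-- The localization of `k[L]` at a coordinate is a polynomial ring with one variable inverted. -/
def coordAwayEquiv : CoordAway k a ≃ₐ[k] ConeChart k e a :=
  AlgEquiv.ofAlgHom (toConeChart k e a) (ofConeChart k e a)
    (by
      refine IsLocalization.algHom_ext
        (Submonoid.powers (X none : MvPolynomial (Option (ChartIndex e a)) k)) ?_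
      refine MvPolynomial.algHom_ext fun o => ?_
      change toConeChart k e a (ofConeChart k e a (algebraMap _ _ (X o))) = algebraMap _ _ (X o)
      rw [ofConeChart_algebraMap]
      cases o with
      | none => simp [ofConePoly, toConeChart_coord, coneCoord]
      | some j => simp [ofConePoly, toConeChart_ratio, chartMonomial_adjust])
    (by
      refine IsLocalization.algHom_ext (Submonoid.powers (coord L k a)) ?_
      refine latticeRing_algHom_ext fun b => ?_
      change ofConeChart k e a (toConeChart k e a (algebraMap _ _ (coord L k b))) =
        algebraMap _ _ (coord L k b)
      rw [toConeChart_coord, coneCoord, ofConeChart_algebraMap, map_mul, ofConePoly_rename,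
        ofChart_chartMonomial, ratio, ofConePoly, aeval_X, ← mul_assoc, Option.elim,
        IsLocalization.Away.mul_invSelf, one_mul])

include e in
theorem isRegularRing_coordAway [∀ i, Finite (C i)] : IsRegularRing (CoordAway k a) := by
  have : IsRegularRing (ConeChart k e a) := isRegularRing_of_isLocalization
    (Submonoid.powers (X none : MvPolynomial (Option (ChartIndex e a)) k))
  exact IsRegularRing.of_ringEquiv (coordAwayEquiv k e a).symm.toRingEquiv

include e in
theorem smooth_coordAway [∀ i, Finite (C i)] : Algebra.Smooth k (CoordAway k a) := by
  have : Algebra.Smooth (MvPolynomial (Option (ChartIndex e a)) k) (ConeChart k e a) :=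
    .of_isLocalization_Away (X none)
  have : Algebra.Smooth k (MvPolynomial (Option (ChartIndex e a)) k) :=
    ⟨inferInstance, inferInstance⟩
  have : Algebra.Smooth k (ConeChart k e a) :=
    .comp k (MvPolynomial (Option (ChartIndex e a)) k) _
  exact .of_equiv (coordAwayEquiv k e a).symm

end Cone

/-! ### The vertex and the irrelevant ideal -/

section Vertex

variable (L) in
theorem exists_sub_algebraMap_mem_vertexIdeal (z : LatticeRing L k) :
    ∃ c : k, z - algebraMap k _ c ∈ vertexIdeal L k := by
  obtain ⟨p, rfl⟩ := Ideal.Quotient.mk_surjective z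
  induction p using MvPolynomial.induction_on with
  | C c =>
    refine ⟨c, ?_⟩
    rw [← MvPolynomial.algebraMap_eq, Ideal.Quotient.mk_algebraMap, sub_self]
    exact zero_mem _
  | add p q hp hq =>
    obtain ⟨c, hc⟩ := hp
    obtain ⟨d, hd⟩ := hq
    refine ⟨c + d, ?_⟩
    rw [map_add, map_add, add_sub_add_comm]
    exact add_mem hc hd
  | mul_X p b _ =>
    refine ⟨0, ?_⟩
    rw [map_mul, map_zero, sub_zero]
    exact Ideal.mul_mem_left _ _ (Ideal.subset_span ⟨b, rfl⟩)

/-- Modulo the vertex ideal every element is a constant, so a prime strictly containing that ideal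
would contain a unit. -/
theorem exists_coord_notMem (p : PrimeSpectrum (LatticeRing L k))
    (hp : p.asIdeal ≠ vertexIdeal L k) : ∃ a, coord L k a ∉ p.asIdeal := by
  by_contra! h
  have hle : vertexIdeal L k ≤ p.asIdeal := Ideal.span_le.2 (by rintro _ ⟨a, rfl⟩; exact h a)
  refine hp (le_antisymm (fun z hz => ?_) hle)
  obtain ⟨c, hc⟩ := exists_sub_algebraMap_mem_vertexIdeal L k z
  have hcp : algebraMap k (LatticeRing L k) c ∈ p.asIdeal := by
    simpa using sub_mem hz (hle hc)
  have hc0 : c = 0 := by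
    by_contra hc0
    exact p.isPrime.ne_top
      (Ideal.eq_top_of_isUnit_mem _ hcp ((isUnit_iff_ne_zero.2 hc0).map (algebraMap k _)))
  simpa [hc0] using hc

theorem coord_mem_grading (a : L) : coord L k a ∈ grading L k 1 :=
  mk_mem_grading (isHomogeneous_X k a)

variable (L) in
theorem irrelevant_le_span_coord :
    (HomogeneousIdeal.irrelevant (grading L k)).toIdeal ≤
      Ideal.span (Set.range (coord L k)) := by
  have hle : vertexIdeal L k ≤ (HomogeneousIdeal.irrelevant (grading L k)).toIdeal := by
    refine Ideal.span_le.2 ?_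
    rintro _ ⟨a, rfl⟩
    change coord L k a ∈ HomogeneousIdeal.irrelevant (grading L k)
    rw [HomogeneousIdeal.mem_irrelevant_iff, GradedRing.proj_apply]
    exact DirectSum.decompose_of_mem_ne _ (coord_mem_grading k a) one_ne_zero
  intro z hz
  obtain ⟨c, hc⟩ := exists_sub_algebraMap_mem_vertexIdeal L k z
  -- The constant term lies in the irrelevant ideal and has degree zero, so it vanishes.
  have h : algebraMap k (LatticeRing L k) c ∈ HomogeneousIdeal.irrelevant (grading L k) := by
    simpa using sub_mem hz (hle hc)
  rw [HomogeneousIdeal.mem_irrelevant_iff, GradedRing.proj_apply,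
    DirectSum.decompose_of_mem_same _ (SetLike.algebraMap_mem_graded (grading L k) c)] at h
  rw [h, sub_zero] at hc
  exact hc

end Vertex

/-! ### Standard affine charts of the projective variety -/

section ProjCharts

theorem _root_.MvPolynomial.IsHomogeneous.aeval_mul {σ R B : Type*} [CommSemiring R]
    [CommSemiring B] [Algebra R B] {p : MvPolynomial σ R} {n : ℕ} (hp : p.IsHomogeneous n) (t : B)
    (g : σ → B) : aeval (fun i => t * g i) p = t ^ n * aeval g p := by
  rw [aeval_def, aeval_def, eval₂_eq, eval₂_eq, Finset.mul_sum]
  refine Finset.sum_congr rfl fun d hd => ?_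
  have hdeg : ∑ i ∈ d.support, d i = n := by
    change d.degree = n
    rw [Finsupp.degree_eq_weight_one]
    exact hp (mem_support_iff.1 hd)
  simp only [mul_pow, Finset.prod_mul_distrib, Finset.prod_pow_eq_pow_sum, hdeg]
  ring

variable {ι : Type u} {C : ι → Type u} [∀ i, LinearOrder (C i)] [Finite ι]
  (e : L ≃o ∀ i, C i) (a : L)

/-- The coordinate ring of the standard affine open `x_a ≠ 0` of the projective variety. -/
abbrev ProjChart : Type (max u v) := HomogeneousLocalization.Away (grading L k) (coord L k a)

theorem algebraMap_mk_of_isHomogeneous {n : ℕ} {p : MvPolynomial L k} (hp : p.IsHomogeneous n) :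
    algebraMap _ (CoordAway k a) (Ideal.Quotient.mk (latticeIdeal L k) p) =
      algebraMap _ (CoordAway k a) (coord L k a) ^ n * aeval (ratio k a) p := by
  rw [← hp.aeval_mul]
  have h : ((IsScalarTower.toAlgHom k (LatticeRing L k) (CoordAway k a)).comp
      (Ideal.Quotient.mkₐ k (latticeIdeal L k))) =
        aeval fun b => algebraMap _ (CoordAway k a) (coord L k a) * ratio k a b := by
    refine MvPolynomial.algHom_ext fun b => ?_
    rw [aeval_X, ratio, ← mul_assoc, IsLocalization.Away.mul_invSelf, one_mul]
    rfl
  exact DFunLike.congr_fun h p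

/-- A degree-zero fraction is `f / x_a ^ n` with `f` homogeneous of degree `n`, that is, `f`
evaluated at the ratios `x_b / x_a`; each ratio is the image of a chart monomial. -/
theorem val_projChart_mem_range (z : ProjChart k a) : z.val ∈ (ofChart k e a).range := by
  obtain ⟨n, x, hx, rfl⟩ :=
    HomogeneousLocalization.Away.mk_surjective (grading L k) (coord_mem_grading k a) z
  obtain ⟨p, hp, hpx⟩ := id hx
  have hp' : p.IsHomogeneous n := by simpa using hp
  refine ⟨aeval (chartMonomial k e a) p, ?_⟩
  have h1 : (ofChart k e a) (aeval (chartMonomial k e a) p) = aeval (ratio k a) p := by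
    rw [← AlgHom.comp_apply, comp_aeval]
    simp only [ofChart_chartMonomial]
  rw [HomogeneousLocalization.Away.val_mk, Localization.mk_eq_mk', eq_comm,
    IsLocalization.mk'_eq_iff_eq_mul, ← hpx]
  change algebraMap _ (CoordAway k a) (Ideal.Quotient.mk (latticeIdeal L k) p) = _
  rw [algebraMap_mk_of_isHomogeneous k a hp', mul_comm, map_pow]
  exact congrArg (· * _) h1.symm

/-- The structure map of a chart. -/
def projChartStructure : k →+* ProjChart k a :=
  (HomogeneousLocalization.fromZeroRingHom (grading L k) _).comp
    (algebraMap k (grading L k 0))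

theorem val_projChartStructure (c : k) :
    (projChartStructure k a c).val = algebraMap k (CoordAway k a) c := by
  change Localization.mk (algebraMap k (LatticeRing L k) c) 1 = _
  rw [Localization.mk_one_eq_algebraMap, ← IsScalarTower.algebraMap_apply]

/-- Dehomogenization of the fractions of degree zero. -/
def projChartHom : ProjChart k a →+* MvPolynomial (ChartIndex e a) k :=
  (toChart k e a).toRingHom.comp (algebraMap (ProjChart k a) (CoordAway k a))

theorem projChartHom_apply (z : ProjChart k a) :
    projChartHom k e a z = toChart k e a z.val := rfl

/-- Injectivity comes from the left inverse of `ofChart`. For surjectivity, constants come from `k`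
and each variable from a single-coordinate ratio. -/
theorem projChartHom_bijective : Function.Bijective (projChartHom k e a) := by
  constructor
  · intro z w h
    obtain ⟨p, hp⟩ := val_projChart_mem_range k e a z
    obtain ⟨q, hq⟩ := val_projChart_mem_range k e a w
    change ofChart k e a p = _ at hp
    change ofChart k e a q = _ at hq
    rw [projChartHom_apply, projChartHom_apply, ← hp, ← hq, toChart_ofChart, toChart_ofChart] at h
    exact HomogeneousLocalization.val_injective _ (by rw [← hp, ← hq, h])
  · intro p
    change p ∈ (projChartHom k e a).range
    induction p using MvPolynomial.induction_on with
    | C c =>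
      refine ⟨projChartStructure k a c, ?_⟩
      rw [projChartHom_apply, val_projChartStructure, AlgHom.commutes]
      rfl
    | add p q hp hq => exact add_mem hp hq
    | mul_X p j hp =>
      refine mul_mem hp ⟨HomogeneousLocalization.Away.mk _ (coord_mem_grading k a) 1
        (coord L k (adjust e a j.1 j.2.1)) (by simpa using coord_mem_grading k _), ?_⟩
      rw [projChartHom_apply, ← chartMonomial_adjust, ← toChart_ratio]
      congr 1
      rw [HomogeneousLocalization.Away.val_mk, Localization.mk_eq_mk',
        IsLocalization.mk'_eq_iff_eq_mul, ratio, mul_right_comm]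
      simp only [pow_one]
      rw [mul_comm _ (algebraMap _ _ (coord L k a)), IsLocalization.Away.mul_invSelf, one_mul]

/-- The standard affine opens of the projective variety are affine spaces. -/
def projChartEquiv : ProjChart k a ≃+* MvPolynomial (ChartIndex e a) k :=
  RingEquiv.ofBijective _ (projChartHom_bijective k e a)

include e in
theorem isRegularRing_projChart [∀ i, Finite (C i)] : IsRegularRing (ProjChart k a) :=
  IsRegularRing.of_ringEquiv (projChartEquiv k e a).symm

include e in
-- Through `projChartEquiv` the structure map becomes the inclusion of the constants in a polynomial
-- ring.
theorem smooth_projChartStructure [∀ i, Finite (C i)] : (projChartStructure k a).Smooth := by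
  have h : projChartStructure k a = ((projChartEquiv k e a).symm : _ →+* ProjChart k a).comp
      (algebraMap k (MvPolynomial (ChartIndex e a) k)) := by
    refine RingHom.ext fun c => (projChartEquiv k e a).injective ?_
    rw [RingHom.comp_apply, RingEquiv.coe_toRingHom, RingEquiv.apply_symm_apply]
    change projChartHom k e a _ = _
    rw [projChartHom_apply, val_projChartStructure, AlgHom.commutes]
  rw [h]
  exact (RingHom.smooth_algebraMap.2 ⟨inferInstance, inferInstance⟩).comp
    (RingHom.Smooth.of_bijective (projChartEquiv k e a).symm.bijective)

end ProjCharts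

end

/-! ### From the charts to the whole projective variety -/

noncomputable section

variable (L : Type u) [DistribLattice L] (k : Type u) [Field k]

/-- The cover of the projective variety by the standard affine opens. -/
def coordCover : (projVariety L k).AffineOpenCover :=
  Proj.affineOpenCoverOfIrrelevantLESpan (grading L k) (coord L k) (m := fun _ => 1)
    (coord_mem_grading k) (fun _ => one_pos) (irrelevant_le_span_coord L k)

variable {L}

theorem isRegularLocalRing_stalk (h : ∀ a : L, IsRegularRing (ProjChart k a))
    (x : projVariety L k) : IsRegularLocalRing ((projVariety L k).presheaf.stalk x) := by
  obtain ⟨i, y, rfl⟩ : ∃ i y, (coordCover L k).f i y = x := ⟨_, (coordCover L k).covers x⟩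
  have : IsRegularRing ((coordCover L k).X i) := h i
  have : IsRegularLocalRing ((Spec ((coordCover L k).X i)).presheaf.stalk y) :=
    IsRegularLocalRing.of_ringEquiv
      (Spec.stalkIso ((coordCover L k).X i) y).symm.commRingCatIsoToRingEquiv
  exact IsRegularLocalRing.of_ringEquiv
    (asIso (((coordCover L k).f i).stalkMap y)).symm.commRingCatIsoToRingEquiv

theorem smooth_structureMorphism (h : ∀ a : L, (projChartStructure k a).Smooth) :
    AlgebraicGeometry.Smooth (structureMorphism L k) := by
  have : IsZariskiLocalAtSource @AlgebraicGeometry.Smooth.{u} :=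
    HasRingHomProperty.instIsZariskiLocalAtSource (Q := RingHom.Smooth)
  refine IsZariskiLocalAtSource.of_openCover (P := @AlgebraicGeometry.Smooth)
    (coordCover L k).openCover fun (a : L) => ?_
  -- Smoothness is local on the source, so only the restriction to each chart matters, and there the
  -- structure morphism is affine.
  have : (coordCover L k).openCover.f a ≫ structureMorphism L k =
      Spec.map (CommRingCat.ofHom (projChartStructure k a)) := by
    change Proj.awayι (grading L k) (coord L k a) (coord_mem_grading k a) one_pos ≫
      Proj.toSpecZero (grading L k) ≫ _ = _
    rw [Proj.awayι_toSpecZero_assoc, ← Spec.map_comp]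
    rfl
  rw [this]
  exact (HasRingHomProperty.Spec_iff (P := @AlgebraicGeometry.Smooth)).2 (h a)

end

end LatticeVariety
open LatticeVariety in
theorem theoremc (L : Type u) [DistribLattice L] [Finite L] (hL : IsSquareLattice L)
    (k : Type u) [Field k] :
    -- the projective variety is nonsingular at all its points, and smooth over the base field
    ((∀ x : projVariety L k, IsRegularLocalRing ((projVariety L k).presheaf.stalk x)) ∧
      AlgebraicGeometry.Smooth (structureMorphism L k)) ∧
    -- the affine cone is nonsingular, and smooth over the base field, away from the vertex
    (∀ p : PrimeSpectrum (LatticeRing L k), p.asIdeal ≠ vertexIdeal L k →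
      IsRegularLocalRing (Localization.AtPrime p.asIdeal) ∧
        Algebra.IsSmoothAt k p.asIdeal) := by
  obtain ⟨ι, C, _, _, _, ⟨e⟩⟩ := hL.exists_orderIso_pi
  refine ⟨⟨isRegularLocalRing_stalk k fun a => isRegularRing_projChart k e a,
    smooth_structureMorphism k fun a => smooth_projChartStructure k e a⟩, fun p hp => ?_⟩
  obtain ⟨a, ha⟩ := exists_coord_notMem k p hp
  have := isRegularRing_coordAway k e a
  have := smooth_coordAway k e a
  exact ⟨isRegularLocalRing_of_isRegularRing_away (S := CoordAway k a) _ p ha,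
    isSmoothAt_of_smooth_away (S := CoordAway k a) _ p ha⟩
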